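/- Let $\mathcal K$ be a field of characteristic zero and let $A_2$ be the free associative unital $\mathcal K$-algebra on two generators, regarded as a Lie algebra with $[a,b]=ab-ba$. Put $L_1(A_2)=A_2$ and $L_{i}(A_2)=[A_2,L_{i-1}(A_2)]$ (the linear span of the brackets) for $i\ge 2$, and let $M_i(A_2)=A_2\,L_i(A_2)\,A_2$ be the two-sided ideal generated by $L_i(A_2)$. For a tuple $i=(i_1,\dots,i_k)$ of integers $i_p\ge 2$, let $\mathrm I(A_2,i)$ denote the largest index $m\ge 1$ such that $M_{i_1}(A_2)\cdots M_{i_k}(A_2)\subset M_m(A_2)$. Then for every such tuple this largest index exists, and $$\mathrm I(A_2,i)=i_1+\cdots+i_k-k+1 .$$ That is, $M_{i_1}(A_2)\cdots M_{i_k}(A_2)\subset M_{i_1+\cdots+i_k-k+1}(A_2)$, and the product is not contained in $M_m(A_2)$ for any $m>i_1+\cdots+i_k-k+1$. -/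

import Mathlib

namespace LowerCentral

attribute [local instance 100] LieRing.ofAssociativeRing

variable (K : Type*) [Field K] (R : Type*) [Ring R] [Algebra K R]

/-- `L_i(R)`, for `i ≥ 1`: the `i`-th term of the lower central series of `R` as a Lie algebra over
`K` with bracket `[a, b] = a * b - b * a`. Thus `L_1(R) = R` and `L_{i+1}(R) = [R, L_i(R)]` (linear
span of the brackets). Mathlib's series starts at index `0`, whence the shift. (The value at
`i = 0` is never used.) -/
def lcsTerm (i : ℕ) : Submodule K R :=
  (LieModule.lowerCentralSeries K R R (i - 1)).toSubmodule

/-- `M_i(R) = R · L_i(R) · R`: the two-sided ideal generated by `L_i(R)`, as a `K`-subspace of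
`R`. -/
def lcsIdeal (i : ℕ) : Submodule K R :=
  ⊤ * lcsTerm K R i * ⊤

/-- The product `M_{i_1}(R) ⋯ M_{i_k}(R)` (in this order): the `K`-span of all products
`m_1 ⋯ m_k` with `m_p ∈ M_{i_p}(R)`. -/
def lcsIdealProd {k : ℕ} (i : Fin k → ℕ) : Submodule K R :=
  (List.ofFn fun p => lcsIdeal K R (i p)).prod

/-- `N = I(R, i)`: `N` is the largest index `m ≥ 1` such that
`M_{i_1}(R) ⋯ M_{i_k}(R) ⊆ M_m(R)`. In particular the product is not contained in
`M_{N+1}(R)`. -/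
def IsMaxContainmentIndex {k : ℕ} (i : Fin k → ℕ) (N : ℕ) : Prop :=
  IsGreatest {m : ℕ | 1 ≤ m ∧ lcsIdealProd K R i ≤ lcsIdeal K R m} N

end LowerCentral

namespace LowerCentral

attribute [local instance 100] LieRing.ofAssociativeRing

/-! ### Consequences of `[M_2, R] ⊆ L_3` in an arbitrary algebra. -/

section General

variable (K : Type*) [Field K] (R : Type*) [Ring R] [Algebra K R]

/-! Give `M_i` the weight `i - 1`; the claim is that weights add exactly under products.
Containment: with two generators `[M_2, A] ⊆ L_3` (`lie_lcsIdeal_two_mem`). This propagates to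
`[M_i, A] ⊆ L_{i+1}` and `[M_i, L_j] ⊆ L_{i+j}` for `i ≥ 2`, whence `M_i M_j ⊆ M_{i+j-1}`
(`lcsIdeal_mul_le`). Sharpness: let the generators act on `K[z][t]` as `t` and `z d/dt`, whose
commutator is the central `z`. Each bracket gains a factor `z`, so `M_{n+1}` maps into multiples of
`z ^ n` (`lcsIdeal_le_weylFiltration`), while the product of the ideals contains an element acting
as `z` to exactly the total weight (`exists_mem_lcsIdealProd_weylRep_eq`). -/

theorem lcsTerm_one : lcsTerm K R 1 = ⊤ := by
  simp [lcsTerm]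

variable {K R}

theorem lie_mem_lcsTerm {n : ℕ} {x : R} (hx : x ∈ lcsTerm K R (n + 1)) (a : R) :
    ⁅a, x⁆ ∈ lcsTerm K R (n + 2) := by
  change ⁅a, x⁆ ∈ LieModule.lowerCentralSeries K R R (n + 1)
  rw [LieModule.lowerCentralSeries_succ]
  exact LieSubmodule.lie_mem_lie (LieSubmodule.mem_top a) hx

theorem lie_mem_lcsTerm' {n : ℕ} {x : R} (hx : x ∈ lcsTerm K R (n + 1)) (a : R) :
    ⁅x, a⁆ ∈ lcsTerm K R (n + 2) := by
  rw [← lie_skew]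
  exact neg_mem (lie_mem_lcsTerm hx a)

theorem lie_mem_lcsTerm_two (a b : R) : ⁅a, b⁆ ∈ lcsTerm K R 2 :=
  lie_mem_lcsTerm (n := 0) (by rw [lcsTerm_one]; trivial) a

theorem lcsTerm_succ_le {n : ℕ} {S : Submodule K R}
    (h : ∀ a : R, ∀ x ∈ lcsTerm K R (n + 1), ⁅a, x⁆ ∈ S) : lcsTerm K R (n + 2) ≤ S := by
  intro y hy
  change y ∈ LieModule.lowerCentralSeries K R R (n + 1) at hy
  rw [LieModule.lowerCentralSeries_succ, ← LieSubmodule.mem_toSubmodule,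
    LieSubmodule.lieIdeal_oper_eq_linear_span'] at hy
  refine Submodule.span_le.2 ?_ hy
  rintro _ ⟨a, -, x, hx, rfl⟩
  exact h a x hx

theorem lcsTerm_succ_le_self (n : ℕ) : lcsTerm K R (n + 2) ≤ lcsTerm K R (n + 1) :=
  LieModule.antitone_lowerCentralSeries K R R (Nat.le_succ n)

/-- `[L_{i+1}, L_{j+1}] ⊆ L_{i+j+2}`. -/
theorem lie_mem_lcsTerm_add {j : ℕ} : ∀ {i : ℕ} {x y : R}, x ∈ lcsTerm K R (i + 1) →
    y ∈ lcsTerm K R (j + 1) → ⁅x, y⁆ ∈ lcsTerm K R (i + j + 2) := by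
  induction j with
  | zero => exact fun hx _ => lie_mem_lcsTerm' hx _
  | succ j ih =>
    intro i x y hx hy
    let S : Submodule K R := (lcsTerm K R (i + (j + 1) + 2)).comap (LieAlgebra.ad K R x)
    refine lcsTerm_succ_le (S := S) (fun a z hz => ?_) hy
    change ⁅x, ⁅a, z⁆⁆ ∈ lcsTerm K R (i + (j + 1) + 2)
    rw [leibniz_lie]
    refine add_mem ?_ (lie_mem_lcsTerm (ih hx hz) a)
    have := ih (lie_mem_lcsTerm' hx a) hz
    rwa [show i + 1 + j + 2 = i + (j + 1) + 2 by ring] at this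

theorem top_mul_top_submodule : (⊤ : Submodule K R) * ⊤ = ⊤ :=
  top_le_iff.1 fun x _ => by
    simpa using Submodule.mul_mem_mul (Submodule.mem_top (R := K) (x := x))
      (Submodule.mem_top (R := K) (x := (1 : R)))

theorem mul_mul_mem_lcsIdeal {i : ℕ} {x : R} (hx : x ∈ lcsTerm K R i) (a b : R) :
    a * x * b ∈ lcsIdeal K R i :=
  Submodule.mul_mem_mul (Submodule.mul_mem_mul trivial hx) trivial

theorem mul_mem_lcsIdeal_of_lcsTerm {i : ℕ} {x : R} (hx : x ∈ lcsTerm K R i) (a : R) :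
    a * x ∈ lcsIdeal K R i := by
  simpa using mul_mul_mem_lcsIdeal hx a 1

theorem mem_lcsIdeal_of_lcsTerm {i : ℕ} {x : R} (hx : x ∈ lcsTerm K R i) :
    x ∈ lcsIdeal K R i := by
  simpa using mul_mul_mem_lcsIdeal hx 1 1

theorem mul_mem_lcsIdeal_right {i : ℕ} {x : R} (hx : x ∈ lcsIdeal K R i) (a : R) :
    x * a ∈ lcsIdeal K R i := by
  have h : lcsIdeal K R i * ⊤ = lcsIdeal K R i := by
    rw [lcsIdeal, mul_assoc, top_mul_top_submodule]
  rw [← h]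
  exact Submodule.mul_mem_mul hx trivial

theorem lcsIdeal_le {i : ℕ} {S : Submodule K R}
    (h : ∀ a, ∀ x ∈ lcsTerm K R i, ∀ b, a * x * b ∈ S) : lcsIdeal K R i ≤ S := by
  rw [lcsIdeal, Submodule.mul_le]
  intro y hy b _
  have : (⊤ : Submodule K R) * lcsTerm K R i ≤ S.comap (LinearMap.mulRight K b) :=
    Submodule.mul_le.2 fun a _ x hx => h a x hx b
  exact this hy

/-- If `[M_{i+1}, R] ⊆ L_{i+2}`, then `[M_{i+1}, L_{j+1}] ⊆ L_{i+j+2}` for all `j`. -/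
theorem lie_lcsIdeal_lcsTerm_mem {i : ℕ}
    (h : ∀ m ∈ lcsIdeal K R (i + 1), ∀ a, ⁅m, a⁆ ∈ lcsTerm K R (i + 2))
    {m : R} (hm : m ∈ lcsIdeal K R (i + 1)) {j : ℕ} :
    ∀ {y : R}, y ∈ lcsTerm K R (j + 1) → ⁅m, y⁆ ∈ lcsTerm K R (i + j + 2) := by
  induction j with
  | zero => exact fun _ => h m hm _
  | succ j ih =>
    intro y hy
    let S : Submodule K R := (lcsTerm K R (i + (j + 1) + 2)).comap (LieAlgebra.ad K R m)
    refine lcsTerm_succ_le (S := S) (fun a z hz => ?_) hy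
    change ⁅m, ⁅a, z⁆⁆ ∈ lcsTerm K R (i + (j + 1) + 2)
    rw [leibniz_lie]
    refine add_mem ?_ (lie_mem_lcsTerm (ih hz) a)
    have := lie_mem_lcsTerm_add (h m hm a) hz
    rwa [show i + 1 + j + 2 = i + (j + 1) + 2 by ring] at this

/-- To check `[M_{i+1}, R] ⊆ L_{i+2}` it suffices to consider the products `a * x` with
`x ∈ L_{i+1}`. -/
theorem lie_lcsIdeal_mem_of_mul {i : ℕ}
    (h : ∀ a, ∀ x ∈ lcsTerm K R (i + 1), ∀ c, ⁅a * x, c⁆ ∈ lcsTerm K R (i + 2))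
    {m : R} (hm : m ∈ lcsIdeal K R (i + 1)) (c : R) : ⁅m, c⁆ ∈ lcsTerm K R (i + 2) := by
  let S : Submodule K R := (lcsTerm K R (i + 2)).comap (LieAlgebra.ad K R c)
  rw [← lie_skew]
  refine neg_mem (lcsIdeal_le (S := S) (fun a x hx b => ?_) hm)
  change ⁅c, a * x * b⁆ ∈ lcsTerm K R (i + 2)
  -- The right factor moves to the left at the cost of a commutator: `axb = [ax, b] + bax`.
  have e : ⁅c, a * x * b⁆ = ⁅c, ⁅a * x, b⁆⁆ - ⁅(b * a) * x, c⁆ := by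
    simp only [Ring.lie_def]; noncomm_ring
  rw [e]
  exact sub_mem (lcsTerm_succ_le_self _ (lie_mem_lcsTerm (h a x hx b) c)) (h _ x hx c)

/-- If `[M_2, R] ⊆ L_3` and `[M_{i+2}, R] ⊆ L_{i+3}`, then `[M_{i+3}, R] ⊆ L_{i+4}`. -/
theorem lie_lcsIdeal_succ_mem {i : ℕ}
    (h2 : ∀ m ∈ lcsIdeal K R 2, ∀ a, ⁅m, a⁆ ∈ lcsTerm K R 3)
    (h : ∀ m ∈ lcsIdeal K R (i + 2), ∀ a, ⁅m, a⁆ ∈ lcsTerm K R (i + 3)) :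
    ∀ m ∈ lcsIdeal K R (i + 3), ∀ a, ⁅m, a⁆ ∈ lcsTerm K R (i + 4) := by
  intro m hm c
  refine lie_lcsIdeal_mem_of_mul (fun a x hx c => ?_) hm c
  let S : Submodule K R := (lcsTerm K R (i + 4)).comap
    ((LieAlgebra.ad K R c) ∘ₗ (LinearMap.mulLeft K a))
  rw [← lie_skew]
  refine neg_mem (lcsTerm_succ_le (S := S) (fun b l hl => ?_) hx)
  change ⁅c, a * ⁅b, l⁆⁆ ∈ lcsTerm K R (i + 4)
  -- The first three terms lie in `[[M_{i+2}, R], R]`, the last in `[M_2, L_{i+2}]`; both are inside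
  -- `L_{i+4}`.
  have e : ⁅c, a * ⁅b, l⁆⁆ =
      ⁅⁅a * l, b⁆, c⁆ + ⁅⁅l * c, a⁆, b⁆ - ⁅⁅l * c, b⁆, a⁆ + ⁅c * ⁅a, b⁆, l⁆ := by
    simp only [Ring.lie_def]; noncomm_ring
  rw [e]
  have hlc : l * c ∈ lcsIdeal K R (i + 2) := by simpa using mul_mul_mem_lcsIdeal hl 1 c
  refine add_mem (sub_mem (add_mem ?_ ?_) ?_) ?_
  · exact lie_mem_lcsTerm' (h _ (mul_mem_lcsIdeal_of_lcsTerm hl a) b) c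
  · exact lie_mem_lcsTerm' (h _ hlc a) b
  · exact lie_mem_lcsTerm' (h _ hlc b) a
  · have := lie_lcsIdeal_lcsTerm_mem (i := 1) h2
      (mul_mem_lcsIdeal_of_lcsTerm (lie_mem_lcsTerm_two a b) c) hl
    rwa [show 1 + (i + 1) + 2 = i + 4 by ring] at this

theorem lie_lcsIdeal_mem (h2 : ∀ m ∈ lcsIdeal K R 2, ∀ a, ⁅m, a⁆ ∈ lcsTerm K R 3) (i : ℕ) :
    ∀ m ∈ lcsIdeal K R (i + 2), ∀ a, ⁅m, a⁆ ∈ lcsTerm K R (i + 3) := by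
  induction i with
  | zero => exact h2
  | succ i ih => exact lie_lcsIdeal_succ_mem h2 ih

/-- If `[M_2, R] ⊆ L_3`, then `M_{i+2} M_{j+1} ⊆ M_{i+j+2}`. -/
theorem lcsIdeal_mul_le (h2 : ∀ m ∈ lcsIdeal K R 2, ∀ a, ⁅m, a⁆ ∈ lcsTerm K R 3) (i j : ℕ) :
    lcsIdeal K R (i + 2) * lcsIdeal K R (j + 1) ≤ lcsIdeal K R (i + j + 2) := by
  rw [Submodule.mul_le]
  intro m hm n hn
  cases j with
  | zero => exact mul_mem_lcsIdeal_right hm n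
  | succ j =>
    refine lcsIdeal_le (S := (lcsIdeal K R (i + (j + 1) + 2)).comap (LinearMap.mulLeft K m))
      (fun a x hx b => ?_) hn
    change m * (a * x * b) ∈ lcsIdeal K R (i + (j + 1) + 2)
    rw [show m * (a * x * b) = m * a * x * b by noncomm_ring]
    refine mul_mem_lcsIdeal_right ?_ b
    have hma := mul_mem_lcsIdeal_right hm a
    generalize m * a = u at hma
    refine lcsTerm_succ_le (S := (lcsIdeal K R (i + (j + 1) + 2)).comap (LinearMap.mulLeft K u))
      (fun c v hv => ?_) hx
    change u * ⁅c, v⁆ ∈ lcsIdeal K R (i + (j + 1) + 2)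
    -- Leibniz turns the product into brackets of `v` with elements of `M_{i+2}`.
    have e : u * ⁅c, v⁆ = ⁅u * c, v⁆ - ⁅u, v⁆ * c := by
      simp only [Ring.lie_def]; noncomm_ring
    have key : ∀ w ∈ lcsIdeal K R (i + 2), ⁅w, v⁆ ∈ lcsTerm K R (i + (j + 1) + 2) := by
      intro w hw
      have := lie_lcsIdeal_lcsTerm_mem (i := i + 1) (lie_lcsIdeal_mem h2 i) hw hv
      rwa [show i + 1 + j + 2 = i + (j + 1) + 2 by ring] at this
    rw [e]
    exact sub_mem (mem_lcsIdeal_of_lcsTerm (key _ (mul_mem_lcsIdeal_right hma c)))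
      (mul_mem_lcsIdeal_right (mem_lcsIdeal_of_lcsTerm (key u hma)) c)

/-- Weights add at each factor; the empty product has weight `0` and is `M_1 = R`. -/
theorem lcsIdealProd_le (h2 : ∀ m ∈ lcsIdeal K R 2, ∀ a, ⁅m, a⁆ ∈ lcsTerm K R 3) :
    ∀ {k : ℕ} (i : Fin k → ℕ), (∀ p, 2 ≤ i p) →
      lcsIdealProd K R i ≤ lcsIdeal K R ((∑ p, (i p - 1)) + 1)
  | 0, i, _ => by
    simp [lcsIdealProd, lcsIdeal, lcsTerm_one, top_mul_top_submodule]
  | k + 1, i, hi => by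
    have ih := lcsIdealProd_le h2 (fun p : Fin k => i p.succ) fun p => hi _
    obtain ⟨n, hn⟩ := Nat.exists_eq_add_of_le' (hi 0)
    rw [lcsIdealProd, List.ofFn_succ, List.prod_cons, Fin.sum_univ_succ, hn]
    refine (mul_le_mul' le_rfl ih).trans ((lcsIdeal_mul_le h2 _ _).trans_eq ?_)
    congr 1
    omega

/-- Modulo `L_3`, the expression `[a[b, c], d]` is skew-symmetric in `a, b`. -/
theorem lie_mul_lie_add_swap_left (a b c d : R) :
    ⁅a * ⁅b, c⁆, d⁆ + ⁅b * ⁅a, c⁆, d⁆ ∈ lcsTerm K R 3 := by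
  have e : ⁅a * ⁅b, c⁆, d⁆ + ⁅b * ⁅a, c⁆, d⁆ = ⁅⁅a * b, c⁆, d⁆ - ⁅⁅⁅a, c⁆, b⁆, d⁆ := by
    simp only [Ring.lie_def]; noncomm_ring
  rw [e]
  exact sub_mem (lie_mem_lcsTerm' (lie_mem_lcsTerm_two _ _) d)
    (lie_mem_lcsTerm' (lie_mem_lcsTerm_two _ _) d)

/-- Modulo `L_3`, the expression `[a[b, c], d]` is skew-symmetric in `a, d`. -/
theorem lie_mul_lie_add_swap_outer (a b c d : R) :
    ⁅a * ⁅b, c⁆, d⁆ + ⁅d * ⁅b, c⁆, a⁆ ∈ lcsTerm K R 3 := by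
  have e : ⁅a * ⁅b, c⁆, d⁆ + ⁅d * ⁅b, c⁆, a⁆ = ⁅⁅b, c⁆, d * a⁆ - ⁅⁅⁅b, c⁆, d⁆, a⁆ := by
    simp only [Ring.lie_def]; noncomm_ring
  rw [e]
  exact sub_mem (lie_mem_lcsTerm' (lie_mem_lcsTerm_two _ _) _)
    (lie_mem_lcsTerm' (lie_mem_lcsTerm_two _ _) _)

/-- Modulo `L_3`, the expression `[a[b, c], d]` is skew-symmetric in `c, d`. -/
theorem lie_mul_lie_add_swap_right (a b c d : R) :
    ⁅a * ⁅b, c⁆, d⁆ + ⁅a * ⁅b, d⁆, c⁆ ∈ lcsTerm K R 3 := by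
  -- The swap of `c, d` is an outer swap, a left swap and an outer swap, linked by the exact
  -- skew-symmetry of the inner bracket.
  have e : ⁅a * ⁅b, c⁆, d⁆ + ⁅a * ⁅b, d⁆, c⁆ =
      (⁅a * ⁅b, c⁆, d⁆ + ⁅d * ⁅b, c⁆, a⁆) + (⁅c * ⁅b, d⁆, a⁆ + ⁅a * ⁅b, d⁆, c⁆)
      + (⁅d * ⁅c, b⁆, a⁆ + ⁅c * ⁅d, b⁆, a⁆) := by
    simp only [Ring.lie_def]; noncomm_ring
  rw [e]
  exact add_mem (add_mem (lie_mul_lie_add_swap_outer _ _ _ _)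
    (lie_mul_lie_add_swap_outer _ _ _ _)) (lie_mul_lie_add_swap_left _ _ _ _)

end General

/-! ### Two generators: `[M_2, A] ⊆ L_3`. -/

section Free

variable {K : Type*} [Field K]

local notation "A" => FreeAlgebra K (Fin 2)

/-- If `[a[b, c], x] ∈ L_3` for all `a` and each generator `x`, then the same holds with any
element in place of the generator. -/
theorem lie_mul_lie_mem_of_generators {b c : A}
    (h : ∀ s a, ⁅a * ⁅b, c⁆, FreeAlgebra.ι K s⁆ ∈ lcsTerm K A 3) (d : A) :
    ∀ a, ⁅a * ⁅b, c⁆, d⁆ ∈ lcsTerm K A 3 := by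
  induction d using FreeAlgebra.induction with
  | grade0 r =>
    intro a
    rw [Ring.lie_def, Algebra.commutes, sub_self]
    exact zero_mem _
  | grade1 s => exact h s
  | add d e hd he =>
    intro a
    rw [lie_add]
    exact add_mem (hd a) (he a)
  | mul d e hd he =>
    intro a
    -- This is `[x, de] = [xd, e] + [ex, d]` with `xd = dx + [x, d]`. The coefficient `a` changes,
    -- so the induction must keep it arbitrary.
    have eq : ⁅a * ⁅b, c⁆, d * e⁆ = ⁅d * a * ⁅b, c⁆, e⁆ + ⁅⁅a * ⁅b, c⁆, d⁆, e⁆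
        + ⁅e * a * ⁅b, c⁆, d⁆ := by
      simp only [Ring.lie_def]; noncomm_ring
    rw [eq]
    exact add_mem (add_mem (he _) (lie_mem_lcsTerm' (lie_mem_lcsTerm_two _ _) _)) (hd _)

theorem mem_of_add_self_mem [CharZero K] {R : Type*} [AddCommGroup R] [Module K R]
    {S : Submodule K R} {x : R} (h : x + x ∈ S) : x ∈ S := by
  rw [← two_smul K] at h
  exact (S.smul_mem_iff two_ne_zero).1 h

/-- Modulo `L_3` the expression is alternating in `b, c, d`, as `2` is invertible. When these are
generators, two of the three coincide, so it vanishes. The slots are then freed from generators one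
at a time, each being permuted into the last position. -/
theorem lie_mul_lie_mem [CharZero K] (a b c d : A) : ⁅a * ⁅b, c⁆, d⁆ ∈ lcsTerm K A 3 := by
  have swap_right : ∀ {a b c d : A}, ⁅a * ⁅b, c⁆, d⁆ ∈ lcsTerm K A 3 →
      ⁅a * ⁅b, d⁆, c⁆ ∈ lcsTerm K A 3 := fun {a b c d} h =>
    (Submodule.add_mem_iff_right _ h).1 (lie_mul_lie_add_swap_right a b c d)
  have swap_mid : ∀ {a b c d : A}, ⁅a * ⁅b, c⁆, d⁆ ∈ lcsTerm K A 3 →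
      ⁅a * ⁅c, b⁆, d⁆ ∈ lcsTerm K A 3 := fun {a b c d} h => by
    rw [← lie_skew c b, mul_neg, neg_lie]
    exact neg_mem h
  have right_self : ∀ a b c : A, ⁅a * ⁅b, c⁆, c⁆ ∈ lcsTerm K A 3 := fun a b c =>
    mem_of_add_self_mem (lie_mul_lie_add_swap_right a b c c)
  have gens : ∀ (s t u : Fin 2) (a : A),
      ⁅a * ⁅FreeAlgebra.ι K s, FreeAlgebra.ι K t⁆, FreeAlgebra.ι K u⁆ ∈ lcsTerm K A 3 := by
    intro s t u a
    by_cases hst : s = t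
    · subst hst
      simp
    by_cases htu : t = u
    · subst htu
      exact right_self _ _ _
    -- Pigeonhole: the only use of there being just two generators.
    have hsu : s = u := by omega
    subst hsu
    exact swap_mid (right_self _ _ _)
  have gens₂ : ∀ (s t : Fin 2) (a d : A),
      ⁅a * ⁅FreeAlgebra.ι K s, FreeAlgebra.ι K t⁆, d⁆ ∈ lcsTerm K A 3 := fun s t a d =>
    lie_mul_lie_mem_of_generators (fun u a => gens s t u a) d a
  have gens₁ : ∀ (s : Fin 2) (a c d : A),
      ⁅a * ⁅FreeAlgebra.ι K s, c⁆, d⁆ ∈ lcsTerm K A 3 := fun s a c d =>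
    lie_mul_lie_mem_of_generators (fun t a => swap_right (gens₂ s t a c)) d a
  refine lie_mul_lie_mem_of_generators (fun s a => ?_) d a
  have h₁ : ⁅a * ⁅c, FreeAlgebra.ι K s⁆, b⁆ ∈ lcsTerm K A 3 := swap_mid (gens₁ s a c b)
  have h₂ : ⁅a * ⁅b, c⁆, FreeAlgebra.ι K s⁆ ∈ lcsTerm K A 3 := swap_mid (swap_right h₁)
  exact h₂

/-- In the free algebra on two generators, `[M_2, A] ⊆ L_3`. -/
theorem lie_lcsIdeal_two_mem [CharZero K] :
    ∀ m ∈ lcsIdeal K A 2, ∀ a, ⁅m, a⁆ ∈ lcsTerm K A 3 := by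
  intro m hm c
  refine lie_lcsIdeal_mem_of_mul (i := 1) (fun a x hx c => ?_) hm c
  let S : Submodule K A := (lcsTerm K A 3).comap
    ((LieAlgebra.ad K A c) ∘ₗ (LinearMap.mulLeft K a))
  rw [← lie_skew]
  refine neg_mem (lcsTerm_succ_le (n := 0) (S := S) (fun b l _ => ?_) hx)
  change ⁅c, a * ⁅b, l⁆⁆ ∈ lcsTerm K A 3
  rw [← lie_skew]
  exact neg_mem (lie_mul_lie_mem a b l c)

/-! ### Sharpness through the homogenized Weyl algebra. -/

open Polynomial

/-- The homogenized Weyl representation: the generators of the free algebra act on `K[z][t]` as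
multiplication by `t` and as `z d/dt`. -/
noncomputable def weylRep (K : Type*) [Field K] :
    FreeAlgebra K (Fin 2) →ₐ[K] Module.End K[X] K[X][X] :=
  FreeAlgebra.lift K ![LinearMap.mulLeft K[X] X, (X : K[X]) • derivative]

theorem weylRep_zero : weylRep K (FreeAlgebra.ι K 0) = LinearMap.mulLeft K[X] X := by
  simp [weylRep]

theorem weylRep_one : weylRep K (FreeAlgebra.ι K 1) = (X : K[X]) • derivative := by
  simp [weylRep]

theorem weylRep_lie_generators :
    weylRep K ⁅FreeAlgebra.ι K (1 : Fin 2), FreeAlgebra.ι K 0⁆ = (X : K[X]) • 1 := by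
  rw [Ring.lie_def, map_sub, map_mul, map_mul, weylRep_zero, weylRep_one]
  refine LinearMap.ext fun v => ?_
  simp only [LinearMap.sub_apply, Module.End.mul_apply, LinearMap.smul_apply,
    LinearMap.mulLeft_apply, derivative_mul, derivative_X, one_mul, Module.End.one_apply,
    mul_smul_comm, smul_add, add_sub_cancel_right]

/-- The elements of the free algebra whose image in the homogenized Weyl algebra is divisible by
`z ^ n` there. -/
noncomputable def weylFiltration (K : Type*) [Field K] (n : ℕ) :
    Submodule K (FreeAlgebra K (Fin 2)) where
  carrier := {a | ∃ c, weylRep K a = (X ^ n : K[X]) • weylRep K c}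
  zero_mem' := ⟨0, by simp⟩
  add_mem' := by
    rintro a b ⟨c, hc⟩ ⟨d, hd⟩
    exact ⟨c + d, by rw [map_add, map_add, hc, hd, smul_add]⟩
  smul_mem' := by
    rintro r a ⟨c, hc⟩
    exact ⟨r • c, by rw [map_smul, map_smul, hc, smul_comm]⟩

theorem mul_mem_weylFiltration_left {n : ℕ} {a : A} (ha : a ∈ weylFiltration K n) (b : A) :
    b * a ∈ weylFiltration K n := by
  obtain ⟨c, hc⟩ := ha
  exact ⟨b * c, by rw [map_mul, map_mul, hc, mul_smul_comm]⟩

theorem mul_mem_weylFiltration_right {n : ℕ} {a : A} (ha : a ∈ weylFiltration K n) (b : A) :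
    a * b ∈ weylFiltration K n := by
  obtain ⟨c, hc⟩ := ha
  exact ⟨c * b, by rw [map_mul, map_mul, hc, smul_mul_assoc]⟩

theorem lie_mem_weylFiltration_of_generators {a : A}
    (h : ∀ s, ⁅a, FreeAlgebra.ι K s⁆ ∈ weylFiltration K 1) (b : A) :
    ⁅a, b⁆ ∈ weylFiltration K 1 := by
  induction b using FreeAlgebra.induction with
  | grade0 r =>
    rw [Ring.lie_def, Algebra.commutes, sub_self]
    exact zero_mem _
  | grade1 s => exact h s
  | add d e hd he =>
    rw [lie_add]
    exact add_mem hd he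
  | mul d e hd he =>
    have eq : ⁅a, d * e⁆ = ⁅a, d⁆ * e + d * ⁅a, e⁆ := by
      simp only [Ring.lie_def]; noncomm_ring
    rw [eq]
    exact add_mem (mul_mem_weylFiltration_right hd e) (mul_mem_weylFiltration_left he d)

/-- The image is commutative modulo `z`: this holds on generators, and the Leibniz rule extends it
in each argument. -/
theorem lie_mem_weylFiltration_one (a b : A) : ⁅a, b⁆ ∈ weylFiltration K 1 := by
  have h10 : ⁅FreeAlgebra.ι K (1 : Fin 2), FreeAlgebra.ι K 0⁆ ∈ weylFiltration K 1 :=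
    ⟨1, by rw [weylRep_lie_generators, map_one, pow_one]⟩
  have gens : ∀ s t : Fin 2, ⁅FreeAlgebra.ι K s, FreeAlgebra.ι K t⁆ ∈ weylFiltration K 1 := by
    intro s t
    by_cases hst : s = t
    · subst hst
      simp
    · obtain ⟨rfl, rfl⟩ | ⟨rfl, rfl⟩ : s = 1 ∧ t = 0 ∨ s = 0 ∧ t = 1 := by omega
      · exact h10
      · rw [← lie_skew]
        exact neg_mem h10
  refine lie_mem_weylFiltration_of_generators (fun s => ?_) b
  rw [← lie_skew]
  exact neg_mem (lie_mem_weylFiltration_of_generators (gens s) a)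

theorem lcsTerm_le_weylFiltration (n : ℕ) : lcsTerm K A (n + 1) ≤ weylFiltration K n := by
  induction n with
  | zero => exact fun a _ => ⟨a, by simp⟩
  | succ n ih =>
    refine lcsTerm_succ_le fun a x hx => ?_
    obtain ⟨c, hc⟩ := ih hx
    -- The quotient by `z ^ n` is again the image of some `c` in the free algebra, so its bracket
    -- with `a` yields one more `z`.
    obtain ⟨d, hd⟩ := lie_mem_weylFiltration_one a c
    refine ⟨d, ?_⟩
    rw [Ring.lie_def, map_sub, map_mul, map_mul] at hd ⊢
    rw [hc, mul_smul_comm, smul_mul_assoc]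
    refine (smul_sub (X ^ n : K[X]) (weylRep K a * weylRep K c)
      (weylRep K c * weylRep K a)).symm.trans ?_
    rw [hd, pow_one, smul_smul, pow_succ]

theorem lcsIdeal_le_weylFiltration (n : ℕ) : lcsIdeal K A (n + 1) ≤ weylFiltration K n :=
  lcsIdeal_le fun a _ hx b => mul_mem_weylFiltration_right
    (mul_mem_weylFiltration_left (lcsTerm_le_weylFiltration n hx) a) b

/-- Since `[z d/dt, z ^ n t ^ (m+1)] = (m+1) z ^ (n+1) t ^ m`, each bracket trades a `t` for a `z`;
characteristic zero allows division by `m + 1`. -/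
theorem exists_mem_lcsTerm_weylRep_eq [CharZero K] (n : ℕ) : ∀ m : ℕ,
    ∃ w ∈ lcsTerm K A (n + 1),
      weylRep K w = (X ^ n : K[X]) • LinearMap.mulLeft K[X] (X ^ m : K[X][X]) := by
  induction n with
  | zero =>
    refine fun m => ⟨FreeAlgebra.ι K 0 ^ m, by rw [lcsTerm_one]; trivial, ?_⟩
    rw [map_pow, weylRep_zero, pow_zero, one_smul, LinearMap.pow_mulLeft]
  | succ n ih =>
    intro m
    obtain ⟨w, hw, hw'⟩ := ih (m + 1)
    refine ⟨((m + 1 : ℕ) : K)⁻¹ • ⁅FreeAlgebra.ι K 1, w⁆,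
      Submodule.smul_mem _ _ (lie_mem_lcsTerm hw _), ?_⟩
    have hm : ((m + 1 : ℕ) : K) ≠ 0 := Nat.cast_ne_zero.2 m.succ_ne_zero
    rw [map_smul, inv_smul_eq_iff₀ hm, Ring.lie_def, map_sub, map_mul, map_mul, hw', weylRep_one,
      Nat.cast_smul_eq_nsmul]
    refine LinearMap.ext fun v => ?_
    simp only [LinearMap.sub_apply, Module.End.mul_apply, LinearMap.smul_apply,
      LinearMap.mulLeft_apply, derivative_smul, derivative_mul, derivative_X_pow,
      Nat.add_sub_cancel]
    simp only [smul_eq_C_mul, nsmul_eq_mul, map_natCast, map_pow]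
    push_cast
    ring

theorem exists_mem_lcsIdealProd_weylRep_eq [CharZero K] : ∀ {k : ℕ} (i : Fin k → ℕ),
    (∀ p, 2 ≤ i p) →
      ∃ w ∈ lcsIdealProd K A i, weylRep K w = (X ^ (∑ p, (i p - 1)) : K[X]) • 1
  | 0, i, _ => ⟨1, by simp [lcsIdealProd], by simp⟩
  | k + 1, i, hi => by
    obtain ⟨w, hw, hw'⟩ := exists_mem_lcsIdealProd_weylRep_eq (fun p : Fin k => i p.succ)
      fun p => hi _
    obtain ⟨n, hn⟩ := Nat.exists_eq_add_of_le' (hi 0)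
    -- With `i 0 = n + 2`, this is an element of `L_{n+2}` acting as the scalar `z ^ (n+1)`.
    obtain ⟨u, hu, hu'⟩ := exists_mem_lcsTerm_weylRep_eq (K := K) (n + 1) 0
    refine ⟨u * w, ?_, ?_⟩
    · rw [lcsIdealProd, List.ofFn_succ, List.prod_cons, hn]
      exact Submodule.mul_mem_mul (mem_lcsIdeal_of_lcsTerm hu) hw
    · rw [map_mul, hu', hw', Fin.sum_univ_succ, hn, pow_zero, LinearMap.mulLeft_one]
      rw [smul_mul_smul_comm, ← pow_add, ← Module.End.one_eq_id, one_mul]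
      rfl

theorem le_of_X_pow_smul_one_eq {s n : ℕ} {f : Module.End K[X] K[X][X]}
    (h : (X ^ s : K[X]) • (1 : Module.End K[X] K[X][X]) = (X ^ n : K[X]) • f) : n ≤ s := by
  -- Evaluating at `1` and taking the constant term in `t` reduces to divisibility of powers of `z`
  -- in `K[z]`.
  have h1 := congrArg (fun g : Module.End K[X] K[X][X] => (g 1).coeff 0) h
  simp only [LinearMap.smul_apply, Module.End.one_apply, coeff_smul, coeff_one_zero,
    smul_eq_mul, mul_one] at h1
  exact (pow_dvd_pow_iff X_ne_zero not_isUnit_X).1 ⟨_, h1⟩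

end Free

end LowerCentral

theorem theorem1 (K : Type*) [Field K] [CharZero K] {k : ℕ} (i : Fin k → ℕ)
    (hi : ∀ p, 2 ≤ i p) :
    LowerCentral.IsMaxContainmentIndex K (FreeAlgebra K (Fin 2)) i ((∑ p, i p) - k + 1) := by
  -- Truncated subtraction is harmless here, since every `i p` is at least `1`.
  have hsum : (∑ p, i p) - k = ∑ p, (i p - 1) := by
    rw [Finset.sum_tsub_distrib _ fun p _ => one_le_two.trans (hi p)]
    simp
  rw [hsum]
  refine ⟨⟨Nat.le_add_left 1 _,
    LowerCentral.lcsIdealProd_le LowerCentral.lie_lcsIdeal_two_mem i hi⟩, ?_⟩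
  rintro m ⟨hm, hle⟩
  obtain ⟨n, rfl⟩ := Nat.exists_eq_add_of_le' hm
  obtain ⟨w, hw, hw'⟩ := LowerCentral.exists_mem_lcsIdealProd_weylRep_eq (K := K) i hi
  obtain ⟨c, hc⟩ := LowerCentral.lcsIdeal_le_weylFiltration n (hle hw)
  exact Nat.succ_le_succ (LowerCentral.le_of_X_pow_smul_one_eq (hw'.symm.trans hc))
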